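/- Let $S$ be a Noetherian commutative ring that is Cohen–Macaulay, and let $I\subsetneq S$ be an ideal of height $c$ such that every $p\in\operatorname{Ass}_S(S/I)$ has height $c$ (that is, $I$ is unmixed) and such that for every $p\in\operatorname{Ass}_S(S/I)$ the ideal $I_p$ is generated by an $S_p$-regular sequence (that is, $I$ is generically a complete intersection). Let $$I^{(2)}=\bigcap_{p\in\operatorname{Ass}_S(S/I)}\bigl(I^2S_p\cap S\bigr)$$ be the second symbolic power of $I$, where $I^2S_p\cap S$ denotes the preimage of $I^2S_p$ in $S$, and let $\mathbf F_c(I)$ be the $c$-th Fitting ideal of the $S$-module $I$, i.e. the ideal generated by the $(\mu-c)$-minors of $\varphi$ for any free presentation $S^q\xrightarrow{\varphi}S^\mu\to I\to 0$ (and $\mathbf F_c(I)=S$ if $c\ge\mu$). Then $$I^{(2)}=I^2:\mathbf F_c(I).$$ Moreover, $I^{(2)}=I^2:\mathbf F_c(I)^t$ for every integer $t\ge 1$; equivalently, $I^{(2)}$ equals the saturation $I^2:\mathbf F_c(I)^\infty=\bigcup_{t\ge1}\bigl(I^2:\mathbf F_c(I)^t\bigr)$, which is thus already attained at exponent $1$.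 -/

import Mathlib

namespace SymbolicFormula

/-- A (Noetherian) local ring is Cohen-Macaulay if its maximal ideal contains a regular sequence
whose length is the Krull dimension, i.e. if its depth equals its dimension. -/
def IsCohenMacaulayLocal (R : Type*) [CommRing R] [IsLocalRing R] : Prop :=
  ∃ rs : List R, (∀ r ∈ rs, r ∈ IsLocalRing.maximalIdeal R) ∧
    RingTheory.Sequence.IsRegular R rs ∧ ((rs.length : ℕ∞) : WithBot ℕ∞) = ringKrullDim R

/-- A (Noetherian) ring is Cohen-Macaulay if all its localizations at primes are. -/
def IsCohenMacaulay (R : Type*) [CommRing R] : Prop :=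
  ∀ p : PrimeSpectrum R, IsCohenMacaulayLocal (Localization.AtPrime p.asIdeal)

/-- `I` is unmixed of height `c`: every associated prime of `R ⧸ I` has height `c`. -/
def IsUnmixedOfHeight {R : Type*} [CommRing R] (I : Ideal R) (c : ℕ) : Prop :=
  ∀ p ∈ associatedPrimes R (R ⧸ I), p.height = c

/-- `I` is generically a complete intersection: for every associated prime `p` of `R ⧸ I` the ideal
`I_p` of `R_p` is generated by an `R_p`-regular sequence. -/
def IsGenericallyCompleteIntersection {R : Type*} [CommRing R] (I : Ideal R) : Prop :=
  ∀ p : PrimeSpectrum R, p.asIdeal ∈ associatedPrimes R (R ⧸ I) →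
    ∃ rs : List (Localization.AtPrime p.asIdeal),
      RingTheory.Sequence.IsRegular (Localization.AtPrime p.asIdeal) rs ∧
        I.map (algebraMap R (Localization.AtPrime p.asIdeal)) = Ideal.ofList rs

/-- The symbolic power `I^(m)`: the intersection over the associated primes `p` of `R ⧸ I` of the
contractions to `R` of the ideals `(I ^ m)_p` of `R_p`. -/
def symbolicPower {R : Type*} [CommRing R] (I : Ideal R) (m : ℕ) : Ideal R :=
  ⨅ (p : PrimeSpectrum R) (_ : p.asIdeal ∈ associatedPrimes R (R ⧸ I)),
    ((I ^ m).map (algebraMap R (Localization.AtPrime p.asIdeal))).comap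
      (algebraMap R (Localization.AtPrime p.asIdeal))

/-- The ideal generated by the `t`-minors of `A`. (Selections with a repeated row or column only
contribute zero determinants, and reorderings only change signs; for `t = 0` this is the unit
ideal, and for `t` larger than the size of `A` it is zero.) -/
def minorsIdeal {R : Type*} [CommRing R] {k l : ℕ} (t : ℕ) (A : Matrix (Fin k) (Fin l) R) :
    Ideal R :=
  Ideal.span {d | ∃ (r : Fin t → Fin k) (s : Fin t → Fin l), d = (A.submatrix r s).det}

/-- The sequence `R^l → R^k → M → 0`, with first map the matrix `A` and second map `π`, is exact. -/
def IsFreePresentation {R M : Type*} [CommRing R] [AddCommGroup M] [Module R M] {k l : ℕ}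
    (A : Matrix (Fin k) (Fin l) R) (π : (Fin k → R) →ₗ[R] M) : Prop :=
  Function.Exact A.mulVecLin π ∧ Function.Surjective π

/-- `F` is the `j`-th Fitting ideal of `M`, computed from some finite free presentation
`R^l → R^k → M → 0`: it is generated by the `(k - j)`-minors of the presentation matrix, and is the
unit ideal for `j ≥ k` (where the subtraction is truncated). -/
def IsFittingIdeal {R : Type*} [CommRing R] (j : ℕ) (M : Type*) [AddCommGroup M] [Module R M]
    (F : Ideal R) : Prop :=
  ∃ (k l : ℕ) (A : Matrix (Fin k) (Fin l) R) (π : (Fin k → R) →ₗ[R] M),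
    IsFreePresentation A π ∧ F = minorsIdeal (k - j) A

/-- The saturation `I : J^∞`, the union of the ascending chain of the `I : J^t`, `t ≥ 1`. -/
def saturation {R : Type*} [CommRing R] (I J : Ideal R) : Ideal R :=
  ⨆ (t : ℕ) (_ : 1 ≤ t), I.colon (J ^ t : Ideal R)

end SymbolicFormula

/-! Let `f` generate `I`, with syzygy matrix `A`. At an associated prime `p`, `I_p` is generated by
a regular sequence of length `c`, so `I_p / I_p ^ 2` is free of rank `c` over `S_p / I_p`. For `x =
∑ v i * f i` in the symbolic square, `v` and the columns of `A` die in `I_p / I_p ^ 2`, so modulo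
`I_p` they lie in a kernel of rank `k - c` and the `(k - c + 1)`-minors of `[v | A]` vanish
(`det_submatrix_mem`). These minors thus lie in `I`, as `I` is detected at its associated primes. By
Cramer's rule (`det_submatrix_mul_sum`), a `(k - c)`-minor of `A` times `x` is a combination of the
`f i` with such coefficients, hence lies in `I ^ 2`. Conversely, `I_p` has `c` generators, so some
`(k - c)`-minor is a unit at `p`, and so are its powers (`exists_mem_minorsIdeal_notMem`). -/

open Matrix in
theorem Matrix.det_mul_eq_zero_of_card_lt {A m k : Type*} [CommRing A] [Fintype m] [DecidableEq m]
    [Fintype k] (L : Matrix m k A) (M : Matrix k m A) (h : Fintype.card k < Fintype.card m) :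
    (L * M).det = 0 := by
  classical
  obtain ⟨e⟩ := Function.Embedding.nonempty_of_card_le h.le
  obtain ⟨b, hb⟩ : ∃ b, ∀ a, e a ≠ b := by
    by_contra! hs
    exact h.not_ge (Fintype.card_le_of_surjective e hs)
  let E : Matrix k m A := (1 : Matrix m m A).submatrix e id
  have hE : E * Eᵀ = 1 := by
    ext i j
    simp [E, Matrix.mul_apply, Matrix.one_apply]
  have hLM : L * M = (L * E) * (Eᵀ * M) := by
    rw [Matrix.mul_assoc, ← Matrix.mul_assoc E, hE, Matrix.one_mul]
  rw [hLM, Matrix.det_mul, Matrix.det_eq_zero_of_column_eq_zero b, zero_mul]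
  intro i
  simp [E, Matrix.mul_apply, hb]

/-- If `Q` is a right inverse of `P` and `P * N = 0`, then the minors of `N` of size larger than
the corank of `P` vanish. -/
theorem Matrix.det_submatrix_eq_zero_of_mul_eq_zero {A m n k : Type*} [CommRing A]
    [Fintype m] [DecidableEq m] [Fintype n] [DecidableEq n] [Fintype k] [DecidableEq k]
    {P : Matrix n k A} {Q : Matrix k n A} {N : Matrix k m A} (hPQ : P * Q = 1) (hPN : P * N = 0)
    (h : Fintype.card k < Fintype.card n + Fintype.card m) (r : m → k) :
    (N.submatrix r id).det = 0 := by
  let E : Matrix m k A := (1 : Matrix k k A).submatrix r id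
  have hEN : E * N = N.submatrix r id := by
    ext i j
    simp [E, Matrix.mul_apply, Matrix.one_apply]
  -- The product is block triangular with diagonal blocks `1` and the chosen rows of `N`, yet it
  -- factors through the smaller index type `k`.
  have := Matrix.det_mul_eq_zero_of_card_lt (Matrix.fromRows P E) (Matrix.fromCols Q N)
    (by simpa using h)
  rwa [Matrix.fromRows_mul_fromCols, hPQ, hPN, hEN, Matrix.det_fromBlocks_zero₁₂, Matrix.det_one,
    one_mul] at this

open Matrix in
theorem Matrix.exists_submatrix_det_ne_zero {K : Type*} [Field K] {k l t : ℕ}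
    (A : Matrix (Fin k) (Fin l) K) (h : t ≤ A.rank) :
    ∃ (r : Fin t → Fin k) (s : Fin t → Fin l), (A.submatrix r s).det ≠ 0 := by
  have key : ∀ {k l : ℕ} (B : Matrix (Fin k) (Fin l) K), t ≤ B.rank →
      ∃ s : Fin t → Fin l, LinearIndependent K (fun j => B.col (s j)) := by
    intro k l B hB
    rw [Matrix.rank_eq_finrank_span_cols] at hB
    obtain ⟨f, hf, -, hli⟩ := Submodule.exists_fun_fin_finrank_span_eq K (Set.range B.col)
    choose s hs using hf
    refine ⟨s ∘ Fin.castLE hB, ?_⟩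
    have hcol : (fun j => B.col ((s ∘ Fin.castLE hB) j)) = f ∘ Fin.castLE hB :=
      funext fun j => hs _
    rw [hcol]
    exact hli.comp (Fin.castLE hB) (Fin.castLE_injective hB)
  obtain ⟨s, hs⟩ := key A h
  have h2 : t ≤ (A.submatrix id s)ᵀ.rank := by
    have : LinearIndependent K (A.submatrix id s)ᵀ.row := hs
    simpa using this.rank_matrix.ge
  obtain ⟨r, hr⟩ := key _ h2
  refine ⟨r, s, fun h0 => ?_⟩
  have hr' : LinearIndependent K (A.submatrix r s).row := hr
  rw [Matrix.linearIndependent_rows_iff_isUnit, Matrix.isUnit_iff_isUnit_det, h0] at hr'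
  exact not_isUnit_zero hr'

/-! ### Regular sequences and localization at associated primes -/

/-- Regularity of the last element puts its coefficient in the ideal of the earlier ones. Expanding
that coefficient turns the relation into a shorter one, to which induction applies. -/
theorem RingTheory.Sequence.IsWeaklyRegular.coeff_mem_ofList {R : Type*} [CommRing R]
    {n : ℕ} {a : Fin n → R} (ha : IsWeaklyRegular R (List.ofFn a)) {r : Fin n → R}
    (h : ∑ i, r i * a i = 0) (i : Fin n) : r i ∈ Ideal.ofList (List.ofFn a) := by
  induction n with
  | zero => exact i.elim0
  | succ n ih =>
    rw [List.ofFn_succ', List.concat_eq_append] at ha ⊢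
    obtain ⟨h1, h2⟩ := (isWeaklyRegular_append_iff R _ _).1 ha
    rw [isWeaklyRegular_singleton_iff] at h2
    set J := Ideal.ofList (List.ofFn fun i : Fin n => a i.castSucc) with hJ
    have haJ : ∀ i : Fin n, a i.castSucc ∈ J := fun i =>
      Ideal.subset_span (by simp)
    rw [Fin.sum_univ_castSucc] at h
    have hlast : r (Fin.last n) ∈ J := by
      have hmem : a (Fin.last n) * r (Fin.last n) ∈ J := by
        have : a (Fin.last n) * r (Fin.last n) = -∑ i : Fin n, r i.castSucc * a i.castSucc := by
          linear_combination h
        rw [this]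
        exact neg_mem (sum_mem fun i _ => J.mul_mem_left _ (haJ i))
      have h0 : Submodule.Quotient.mk (p := J • (⊤ : Submodule R R)) (r (Fin.last n)) = 0 := by
        apply h2
        change a (Fin.last n) • _ = a (Fin.last n) • _
        rw [smul_zero, ← Submodule.Quotient.mk_smul, Submodule.Quotient.mk_eq_zero]
        simpa using hmem
      rw [Submodule.Quotient.mk_eq_zero] at h0
      simpa using h0
    obtain ⟨s, hs⟩ : ∃ s : Fin n → R, ∑ i, s i * a i.castSucc = r (Fin.last n) := by
      have : r (Fin.last n) ∈ Ideal.span (Set.range fun i : Fin n => a i.castSucc) := by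
        convert hlast using 2
        ext; simp
      exact Ideal.mem_span_range_iff_exists_fun.1 this
    have hcs : ∀ i : Fin n, r i.castSucc ∈ J ⊔ Ideal.ofList [a (Fin.last n)] := by
      intro i
      have := ih h1 (r := fun i => r i.castSucc + s i * a (Fin.last n)) (by
        rw [← hs, Finset.sum_mul, ← Finset.sum_add_distrib] at h
        rw [← h]
        exact Finset.sum_congr rfl fun i _ => by ring) i
      have hr : r i.castSucc = (r i.castSucc + s i * a (Fin.last n)) - s i * a (Fin.last n) := by
        ring
      rw [hr]
      exact sub_mem (Ideal.mem_sup_left this) (Ideal.mem_sup_right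
        (Ideal.mul_mem_left _ _ (Ideal.subset_span (by simp))))
    rw [Ideal.ofList_append]
    induction i using Fin.lastCases with
    | last => exact Ideal.mem_sup_left hlast
    | cast i => exact hcs i

theorem SymbolicFormula.mem_of_forall_associatedPrimes {S : Type*} [CommRing S]
    [IsNoetherianRing S] (I : Ideal S) {x : S}
    (hx : ∀ p : PrimeSpectrum S, p.asIdeal ∈ associatedPrimes S (S ⧸ I) →
      algebraMap S (Localization.AtPrime p.asIdeal) x ∈
        I.map (algebraMap S (Localization.AtPrime p.asIdeal))) : x ∈ I := by
  by_contra hxI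
  obtain ⟨P, hP, hle⟩ := exists_le_isAssociatedPrime_of_isNoetherianRing S
    (Ideal.Quotient.mk I x) (by rwa [Ne, Ideal.Quotient.eq_zero_iff_mem])
  have := hP.isPrime
  have h := hx ⟨P, this⟩ hP
  rw [IsLocalization.algebraMap_mem_map_algebraMap_iff P.primeCompl] at h
  obtain ⟨s, hs, hsx⟩ := h
  refine hs (hle ?_)
  rw [Submodule.mem_colon_singleton]
  change Ideal.Quotient.mk I (s * x) = 0
  rwa [Ideal.Quotient.eq_zero_iff_mem]

/-- One bound holds because a regular sequence lowers the dimension by its length, the other by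
Krull's height theorem. -/
theorem SymbolicFormula.length_eq_of_isRegular {S : Type*} [CommRing S] [IsNoetherianRing S]
    {I p : Ideal S} [p.IsPrime] {c : ℕ} (hI : I.height = c) (hp : p.height = c)
    {rs : List (Localization.AtPrime p)}
    (hrs : RingTheory.Sequence.IsRegular (Localization.AtPrime p) rs)
    (h : I.map (algebraMap S (Localization.AtPrime p)) = Ideal.ofList rs) : rs.length = c := by
  have htop : Ideal.ofList rs ≠ ⊤ := fun h => hrs.top_ne_smul (by simp [h])
  apply le_antisymm
  · have h1 := ringKrullDim_add_length_eq_ringKrullDim_of_isRegular rs hrs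
    rw [IsLocalization.AtPrime.ringKrullDim_eq_height p
      (Localization.AtPrime p), hp] at h1
    have : Nontrivial (Localization.AtPrime p ⧸ Ideal.ofList rs) :=
      Ideal.Quotient.nontrivial_iff.2 htop
    have h2 : (0 : WithBot ℕ∞) ≤ ringKrullDim (Localization.AtPrime p ⧸ Ideal.ofList rs) :=
      ringKrullDim_nonneg_of_nontrivial
    have h3 : (rs.length : WithBot ℕ∞) ≤ ((c : ℕ∞) : WithBot ℕ∞) := by
      rw [← h1]
      exact le_add_of_nonneg_left h2
    exact_mod_cast h3
  · have h1 : (Ideal.ofList rs).height ≤ rs.length := by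
      classical
      obtain ⟨q, hq⟩ := Ideal.nonempty_minimalPrimes htop
      have := hq.1.1
      rw [Ideal.height_eq_inf_minimalPrimes]
      refine (iInf₂_le q hq).trans ?_
      have hq' : q ∈ (Ideal.span (rs.toFinset : Set (Localization.AtPrime p))).minimalPrimes := by
        simpa [Ideal.ofList] using hq
      exact (Ideal.height_le_card_of_mem_minimalPrimes_span_finset hq').trans
        (by exact_mod_cast rs.toFinset_card_le)
    have h2 : (c : ℕ∞) ≤ (Ideal.ofList rs).height := by
      rw [Ideal.height_eq_inf_minimalPrimes]
      refine le_iInf₂ fun q hq => ?_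
      have := hq.1.1
      rw [← IsLocalization.height_under p.primeCompl, ← hI]
      exact Ideal.height_mono (Ideal.map_le_iff_le_comap.1 (h ▸ hq.1.2))
    exact_mod_cast h2.trans h1

/-! ### Minors of the presentation matrix -/

/-- Laplace expansion along the row `i`: after summing against `f`, only the entry `v i`
contributes, since the columns of `A` are syzygies of `f`. -/
theorem Matrix.det_submatrix_mul_sum {S : Type*} [CommRing S] {k l t : ℕ}
    (A : Matrix (Fin k) (Fin l) S) {f : Fin k → S} (hf : ∀ j, ∑ i, A i j * f i = 0)
    (v : Fin k → S) (r : Fin t → Fin k) (s : Fin t → Fin l) :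
    (A.submatrix r s).det * ∑ i, v i * f i =
      ∑ i, ((Matrix.of fun i => (Fin.cons (v i) (fun j => A i (s j)) : Fin (t + 1) → S)).submatrix
        (Fin.cons i r : Fin (t + 1) → Fin k) id).det * f i := by
  set N : Matrix (Fin k) (Fin (t + 1)) S := Matrix.of fun i => Fin.cons (v i) (fun j => A i (s j))
  have hdet : ∀ i, (N.submatrix (Fin.cons i r : Fin (t + 1) → Fin k) id).det =
      v i * (A.submatrix r s).det + ∑ j : Fin t, A i (s j) *
        ((-1) ^ (j + 1 : ℕ) * (N.submatrix r j.succ.succAbove).det) := by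
    intro i
    rw [Matrix.det_succ_row_zero, Fin.sum_univ_succ]
    congr 1
    · have : (N.submatrix (Fin.cons i r : Fin (t + 1) → Fin k) id).submatrix Fin.succ
          (Fin.succAbove 0) = A.submatrix r s := by
        ext a b
        simp [N]
      rw [this]
      simp [N]
    · refine Finset.sum_congr rfl fun j _ => ?_
      have : (N.submatrix (Fin.cons i r : Fin (t + 1) → Fin k) id).submatrix Fin.succ
          j.succ.succAbove = N.submatrix r j.succ.succAbove := by
        ext a b
        simp
      rw [this]
      simp [N]
      ring
  simp only [hdet, add_mul, Finset.sum_add_distrib, Finset.sum_mul]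
  rw [Finset.sum_comm (s := Finset.univ (α := Fin k)) (t := Finset.univ (α := Fin t)),
    Finset.sum_eq_zero (s := Finset.univ (α := Fin t)), add_zero, Finset.mul_sum]
  · exact Finset.sum_congr rfl fun i _ => by ring
  · intro j _
    calc _ = (∑ i, A i (s j) * f i) *
            ((-1) ^ (j + 1 : ℕ) * (N.submatrix r j.succ.succAbove).det) := by
          rw [Finset.sum_mul]
          exact Finset.sum_congr rfl fun i _ => by ring
      _ = 0 := by rw [hf, zero_mul]

theorem RingTheory.Sequence.IsWeaklyRegular.det_submatrix_mem {R : Type*} [CommRing R] {k m n : ℕ}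
    {a : Fin n → R} (ha : IsWeaklyRegular R (List.ofFn a)) {J : Ideal R}
    (haJ : Ideal.ofList (List.ofFn a) = J) {f : Fin k → R} (hf : Ideal.span (Set.range f) = J)
    {N : Matrix (Fin k) (Fin m) R} (hN : ∀ b, ∑ i, N i b * f i ∈ J ^ 2) (hlt : k < n + m)
    (r : Fin m → Fin k) : (N.submatrix r id).det ∈ J := by
  have hspan : Ideal.span (Set.range a) = J := by
    rw [← haJ]
    congr 1
    ext; simp
  have hmem : ∀ x ∈ J, ∃ c : Fin n → R, ∑ j, c j * a j = x := fun x hx =>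
    Ideal.mem_span_range_iff_exists_fun.1 (hspan ▸ hx)
  -- The `a j` are independent modulo `J ^ 2`: subtracting an expression with coefficients in `J`
  -- leaves a genuine relation.
  have hcoeff : ∀ c : Fin n → R, ∑ j, c j * a j ∈ J ^ 2 → ∀ j, c j ∈ J := by
    intro c hc j
    obtain ⟨d, hdJ, hd⟩ : ∃ d : Fin n → R, (∀ j, d j ∈ J) ∧ ∑ j, d j * a j = ∑ j, c j * a j := by
      rw [sq] at hc
      nth_rw 2 [← hspan] at hc
      obtain ⟨d, hdJ, hd⟩ := (Submodule.mem_ideal_smul_span_iff_exists_sum J a _).1 hc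
      refine ⟨d, hdJ, ?_⟩
      rw [← hd, Finsupp.sum_fintype _ _ (by simp)]
      rfl
    have := ha.coeff_mem_ofList (r := fun j => c j - d j)
      (by simp [sub_mul, Finset.sum_sub_distrib, hd]) j
    rw [haJ] at this
    simpa using add_mem this (hdJ j)
  choose P hP using fun i => hmem (f i) (hf ▸ Ideal.subset_span ⟨i, rfl⟩)
  have hQ' : ∀ j, ∃ q : Fin k → R, ∑ i, q i * f i = a j := fun j =>
    Ideal.mem_span_range_iff_exists_fun.1 (hf ▸ hspan ▸ Ideal.subset_span ⟨j, rfl⟩)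
  choose Q hQ using hQ'
  have hcomb : ∀ c : Fin k → R, ∑ j, (∑ i, P i j * c i) * a j = ∑ i, c i * f i := by
    intro c
    simp_rw [← hP, Finset.mul_sum, Finset.sum_mul]
    rw [Finset.sum_comm]
    exact Finset.sum_congr rfl fun _ _ => Finset.sum_congr rfl fun _ _ => by ring
  let φ := Ideal.Quotient.mk J
  let P' : Matrix (Fin n) (Fin k) (R ⧸ J) := Matrix.of fun j i => φ (P i j)
  let Q' : Matrix (Fin k) (Fin n) (R ⧸ J) := Matrix.of fun i j => φ (Q j i)
  -- `P'` expresses `f` through `a` and `Q'` expresses `a` through `f`, modulo `J`.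
  have h1 : P' * Q' = 1 := by
    ext j j'
    have := hcoeff (fun j => ∑ i, P i j * Q j' i - (1 : Matrix (Fin n) (Fin n) R) j j') (by
      simp [sub_mul, Finset.sum_sub_distrib, hcomb, hQ, Matrix.one_apply]) j
    rw [← Ideal.Quotient.eq_zero_iff_mem, map_sub, sub_eq_zero] at this
    simpa [P', Q', φ, Matrix.mul_apply, Matrix.one_apply, apply_ite] using this
  have h2 : P' * N.map φ = 0 := by
    ext j b
    have := hcoeff (fun j => ∑ i, P i j * N i b) (by rw [hcomb]; exact hN b) j
    rw [← Ideal.Quotient.eq_zero_iff_mem] at this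
    simpa [P', φ, Matrix.mul_apply] using this
  have h3 := Matrix.det_submatrix_eq_zero_of_mul_eq_zero h1 h2 (by simpa using hlt) r
  rw [← Ideal.Quotient.eq_zero_iff_mem, RingHom.map_det]
  exact h3

namespace SymbolicFormula

-- Over the residue field, the columns of `A` and lifts of at most `c` local generators of `I` span
-- the whole space, so `A` has rank at least `k - c` there.
open Matrix in
theorem exists_mem_minorsIdeal_notMem {S : Type*} [CommRing S] {I p : Ideal S} [p.IsPrime]
    {rs : List (Localization.AtPrime p)} {c : ℕ} (hc : rs.length ≤ c)
    (h : I.map (algebraMap S (Localization.AtPrime p)) = Ideal.ofList rs)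
    {k l : ℕ} {A : Matrix (Fin k) (Fin l) S} {π : (Fin k → S) →ₗ[S] I}
    (hA : IsFreePresentation A π) : ∃ y ∈ minorsIdeal (k - c) A, y ∉ p := by
  let φ : S →+* p.ResidueField := algebraMap S p.ResidueField
  have hφ : ∀ x, φ x = 0 ↔ x ∈ p := fun x => Ideal.algebraMap_residueField_eq_zero
  have hg : ∀ j : Fin rs.length, ∃ (g : I) (s : p.primeCompl),
      rs[j] * algebraMap S (Localization.AtPrime p) s = algebraMap S _ (g : S) := by
    intro j
    have : rs[j] ∈ I.map (algebraMap S (Localization.AtPrime p)) :=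
      h ▸ Ideal.subset_span (List.getElem_mem _)
    obtain ⟨⟨g, s⟩, hgs⟩ := (IsLocalization.mem_map_algebraMap_iff p.primeCompl _).1 this
    exact ⟨g, s, hgs⟩
  choose g d hgd using hg
  let G : Ideal S := Ideal.span (Set.range fun j => (g j : S))
  have hG : I.map (algebraMap S (Localization.AtPrime p)) ≤
      G.map (algebraMap S (Localization.AtPrime p)) := by
    rw [h, Ideal.span_le]
    intro x hx
    obtain ⟨j, hj, rfl⟩ := List.mem_iff_getElem.1 hx
    have hu := IsLocalization.map_units (Localization.AtPrime p) (d ⟨j, hj⟩)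
    refine (Ideal.mul_unit_mem_iff_mem _ hu).1 ?_
    have := hgd ⟨j, hj⟩
    simp only [Fin.getElem_fin] at this
    rw [this]
    exact Ideal.mem_map_of_mem _ (Ideal.subset_span ⟨_, rfl⟩)
  choose w hw using fun j => hA.2 (g j)
  let φv : (Fin k → S) → (Fin k → p.ResidueField) := fun u i => φ (u i)
  let W : Submodule p.ResidueField (Fin k → p.ResidueField) :=
    Submodule.span _ (Set.range fun j => φv (w j))
  have htop : W ⊔ LinearMap.range (A.map φ).mulVecLin = ⊤ := by
    rw [eq_top_iff, ← (Pi.basisFun p.ResidueField (Fin k)).span_eq, Submodule.span_le]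
    rintro _ ⟨i, rfl⟩
    have hi : algebraMap S (Localization.AtPrime p) (π (Pi.single i 1) : S) ∈
        G.map (algebraMap S (Localization.AtPrime p)) :=
      hG (Ideal.mem_map_of_mem _ (π (Pi.single i 1)).2)
    rw [IsLocalization.algebraMap_mem_map_algebraMap_iff p.primeCompl] at hi
    obtain ⟨s, hs, hsG⟩ := hi
    obtain ⟨q, hq⟩ := Ideal.mem_span_range_iff_exists_fun.1 hsG
    -- With denominators cleared by `s ∉ p`, this difference is a syzygy, hence in the image of `A`.
    have hker : π (s • Pi.single i 1 - ∑ j, q j • w j) = 0 := by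
      ext
      simp [hw, ← hq]
    obtain ⟨u, hu⟩ := (hA.1 _).1 hker
    have hs0 : φ s ≠ 0 := fun h0 => hs ((hφ s).1 h0)
    have key : φ s • (Pi.basisFun p.ResidueField (Fin k)) i =
        ∑ j, φ (q j) • φv (w j) + (A.map φ).mulVecLin (fun b => φ (u b)) := by
      ext a
      have := congrArg φ (congrFun hu a)
      simp [Matrix.mulVec, dotProduct, Pi.single_apply, apply_ite φ] at this ⊢
      rw [this]
      simp [φv]
    refine (Submodule.smul_mem_iff _ hs0).1 ?_
    rw [key]
    exact add_mem (Submodule.mem_sup_left (sum_mem fun j _ =>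
      Submodule.smul_mem _ _ (Submodule.subset_span ⟨j, rfl⟩))) (Submodule.mem_sup_right ⟨_, rfl⟩)
  have hrank : k - c ≤ (A.map φ).rank := by
    have h1 := Submodule.finrank_add_le_finrank_add_finrank W (LinearMap.range (A.map φ).mulVecLin)
    rw [htop, finrank_top, Module.finrank_fin_fun] at h1
    have h2 : Module.finrank p.ResidueField W ≤ rs.length :=
      (finrank_range_le_card (R := p.ResidueField) (fun j => φv (w j))).trans_eq (by simp)
    have h3 : (A.map φ).rank = Module.finrank _ (LinearMap.range (A.map φ).mulVecLin) := rfl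
    omega
  obtain ⟨r, s, hrs⟩ := (A.map φ).exists_submatrix_det_ne_zero hrank
  refine ⟨_, Ideal.subset_span ⟨r, s, rfl⟩, fun hmem => hrs ?_⟩
  rw [← hφ, RingHom.map_det] at hmem
  exact hmem

end SymbolicFormula

/-! ### The formula for the symbolic square -/

theorem theorem5p6 {S : Type*} [CommRing S] [IsNoetherianRing S]
    (hS : SymbolicFormula.IsCohenMacaulay S)
    (I : Ideal S) (c : ℕ) (hc : I.height = c)
    (hI : SymbolicFormula.IsUnmixedOfHeight I c)
    (hgci : SymbolicFormula.IsGenericallyCompleteIntersection I)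
    (F : Ideal S) (hF : SymbolicFormula.IsFittingIdeal c I F) :
    SymbolicFormula.symbolicPower I 2 = (I ^ 2).colon F ∧
      (∀ t : ℕ, 1 ≤ t → SymbolicFormula.symbolicPower I 2 = (I ^ 2).colon (F ^ t : Ideal S)) ∧
      SymbolicFormula.symbolicPower I 2 = SymbolicFormula.saturation (I ^ 2) F := by
  obtain ⟨k, l, A, π, hA, rfl⟩ := hF
  set F := SymbolicFormula.minorsIdeal (k - c) A with hFdef
  have hsymb : ∀ x, x ∈ SymbolicFormula.symbolicPower I 2 ↔
      ∀ p : PrimeSpectrum S, p.asIdeal ∈ associatedPrimes S (S ⧸ I) →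
        algebraMap S (Localization.AtPrime p.asIdeal) x ∈
          (I ^ 2).map (algebraMap S (Localization.AtPrime p.asIdeal)) := by
    intro x
    simp [SymbolicFormula.symbolicPower, Submodule.mem_iInf]
  have hup : SymbolicFormula.symbolicPower I 2 ≤ (I ^ 2).colon F := by
    intro x hx
    rw [hsymb] at hx
    have hxI : x ∈ I := SymbolicFormula.mem_of_forall_associatedPrimes I fun p hp =>
      Ideal.map_mono (Ideal.pow_le_self two_ne_zero) (hx p hp)
    obtain ⟨v, hv⟩ := hA.2 ⟨x, hxI⟩
    let f : Fin k → S := fun i => π (Pi.single i 1)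
    have hπ : ∀ u : Fin k → S, (π u : S) = ∑ i, u i * f i := by
      intro u
      conv_lhs => rw [pi_eq_sum_univ' u]
      simp [f]
    have hfI : Ideal.span (Set.range f) = I := by
      apply le_antisymm
      · rw [Ideal.span_le]
        rintro _ ⟨i, rfl⟩
        exact (π _).2
      · intro y hy
        obtain ⟨u, hu⟩ := hA.2 ⟨y, hy⟩
        exact Ideal.mem_span_range_iff_exists_fun.2 ⟨u, by rw [← hπ, hu]⟩
    have hAf : ∀ j, ∑ i, A i j * f i = 0 := by
      intro j
      have h0 : π (A.mulVecLin (Pi.single j 1)) = 0 := hA.1.apply_apply_eq_zero _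
      simpa [hπ] using congrArg Subtype.val h0
    rw [Submodule.mem_colon]
    suffices F ≤ (I ^ 2).colon {x} by
      intro y hy
      have := this hy
      rw [Submodule.mem_colon_singleton] at this
      simpa [mul_comm] using this
    rw [hFdef, SymbolicFormula.minorsIdeal, Ideal.span_le]
    rintro _ ⟨r, s, rfl⟩
    rw [SetLike.mem_coe, Submodule.mem_colon_singleton, smul_eq_mul]
    have hx' : x = ∑ i, v i * f i := by rw [← hπ, hv]
    nth_rw 1 [hx']
    rw [Matrix.det_submatrix_mul_sum A hAf, sq]
    -- One factor of `I` comes from `f i`; the determinant must supply the other.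
    refine sum_mem fun i _ => Ideal.mul_mem_mul ?_ (π _).2
    apply SymbolicFormula.mem_of_forall_associatedPrimes
    intro p hp
    obtain ⟨rs, hreg, hrs⟩ := hgci p hp
    have hlen := SymbolicFormula.length_eq_of_isRegular hc (hI _ hp) hreg hrs
    have hofFn : List.ofFn rs.get = rs := List.ofFn_get rs
    rw [RingHom.map_det]
    have hw : RingTheory.Sequence.IsWeaklyRegular (Localization.AtPrime p.asIdeal)
      (List.ofFn rs.get) := hofFn.symm ▸ hreg.toIsWeaklyRegular
    refine hw.det_submatrix_mem (by rw [hofFn, hrs])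
      (f := fun i => algebraMap S (Localization.AtPrime p.asIdeal) (f i))
      (N := (Matrix.of fun i => (Fin.cons (v i) (fun j => A i (s j)) : Fin (k - c + 1) → S)).map
        (algebraMap S (Localization.AtPrime p.asIdeal))) ?_ ?_ (by omega) (Fin.cons i r)
    · rw [← hfI, Ideal.map_span, ← Set.range_comp]
      rfl
    · intro b
      -- The column `v` pairs with `f` to `x`, locally in `I ^ 2`; the columns of `A` pair to zero.
      rw [← Ideal.map_pow]
      induction b using Fin.cases with
      | zero => simpa [hx'] using hx p hp
      | succ b =>
        have := congrArg (algebraMap S (Localization.AtPrime p.asIdeal)) (hAf (s b))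
        simp only [map_sum, map_mul, map_zero] at this
        simp [this]
  have hdown : ∀ t : ℕ, (I ^ 2).colon (F ^ t : Ideal S) ≤ SymbolicFormula.symbolicPower I 2 := by
    intro t x hx
    rw [hsymb]
    intro p hp
    obtain ⟨rs, hreg, hrs⟩ := hgci p hp
    have hlen := SymbolicFormula.length_eq_of_isRegular hc (hI _ hp) hreg hrs
    obtain ⟨y, hyF, hyp⟩ := SymbolicFormula.exists_mem_minorsIdeal_notMem hlen.le hrs hA
    rw [IsLocalization.algebraMap_mem_map_algebraMap_iff p.asIdeal.primeCompl]
    refine ⟨y ^ t, fun h => hyp (p.2.mem_of_pow_mem _ h), ?_⟩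
    rw [mul_comm]
    exact Submodule.mem_colon.1 hx _ (Ideal.pow_mem_pow hyF t)
  have heq : ∀ t : ℕ, 1 ≤ t →
      SymbolicFormula.symbolicPower I 2 = (I ^ 2).colon (F ^ t : Ideal S) := fun t ht =>
    le_antisymm (hup.trans (Submodule.colon_mono le_rfl
      (Ideal.pow_le_self (Nat.one_le_iff_ne_zero.1 ht)))) (hdown t)
  refine ⟨by simpa using heq 1 le_rfl, heq, ?_⟩
  exact le_antisymm ((heq 1 le_rfl).le.trans (le_iSup₂_of_le 1 le_rfl le_rfl))
    (iSup₂_le fun t _ => hdown t)
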